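/- **Lemma 4.2.** Let $(M_1,g_1,J)$ be a Kähler manifold: $g_1$ is a Riemannian metric and $J$ a smooth $(1,1)$-tensor field on $M_1$ with $J^2=-I$, $g_1(JX,JY)=g_1(X,Y)$ and $\nabla J=0$, where $\nabla$ is the Levi-Civita connection of $g_1$. Let $(M_2,g_2)$ be a Riemannian manifold and let $F:M_1\to M_2$ be a Riemannian submersion, i.e. a smooth surjective map whose differential $F_*$ is surjective at every point and isometric on the horizontal spaces $(\ker F_*)^\perp$. Suppose that $F$ is semi-invariant: there is a smooth distribution $\mathcal D_1\subseteq\ker F_*$ such that $$J\mathcal D_1=\mathcal D_1,\qquad J\mathcal D_2\subseteq(\ker F_*)^\perp,$$ where $\mathcal D_2$ is the orthogonal complement of $\mathcal D_1$ in $\ker F_*$. Assume that $\mathcal D_1\neq 0$ at every point. Let $\mu$ be the orthogonal complement of $J\mathcal D_2$ in $(\ker F_*)^\perp$. Let $\mathcal V,\mathcal H$ be the orthogonal projections onto $\ker F_*$ and $(\ker F_*)^\perp$, let $$\mathcal T_EG=\mathcal H\nabla_{\mathcal VE}\mathcal VG+\mathcal V\nabla_{\mathcal VE}\mathcal HG$$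 be O'Neill's tensor, and let $H=\frac1r\sum_{i=1}^r\mathcal T_{e_i}e_i$ be the mean curvature vector field of the fibers, where $e_1,\dots,e_r$ is an orthonormal basis of $\ker F_*$ at the point in question. Suppose that the fibers of $F$ are totally umbilical, i.e. $\mathcal T_XY=g_1(X,Y)H$ for all $X,Y\in\Gamma(\ker F_*)$. Then $H\in\Gamma(J\mathcal D_2)$, i.e. $H$ is a smooth vector field with $H_p\in J\mathcal D_2(p)$ for every $p\in M_1$; equivalently, $H$ is smooth and its component in $\mu$ vanishes at every point. -/

import Mathlib

open Bundle Module
open scoped Manifold ContDiff Topology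

namespace SemiInvariantSubmersion

noncomputable section

/-- The normalized metric trace `(1/r) ∑ᵢ B(eᵢ, eᵢ)` of `B` on the subspace `S`, where `e₁, …, e_r` is
an orthonormal basis of `S`. -/
def normalizedTrace {T : Type*} [NormedAddCommGroup T] [InnerProductSpace ℝ T]
    [FiniteDimensional ℝ T] (S : Submodule ℝ T) (B : T → T → T) : T :=
  (finrank ℝ S : ℝ)⁻¹ •
    ∑ i, B (stdOrthonormalBasis ℝ S i : T) (stdOrthonormalBasis ℝ S i : T)

variable
  {V : Type*} [NormedAddCommGroup V] [NormedSpace ℝ V] [FiniteDimensional ℝ V]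
  {M : Type*} [TopologicalSpace M] [ChartedSpace V M] [IsManifold 𝓘(ℝ, V) ∞ M]
  {W : Type*} [NormedAddCommGroup W] [NormedSpace ℝ W]
  {N : Type*} [TopologicalSpace N] [ChartedSpace W N]

/-- The vector field `X` is smooth on the set `s`. -/
def SmoothFieldOn (X : Π x : M, TangentSpace 𝓘(ℝ, V) x) (s : Set M) : Prop :=
  ContMDiffOn 𝓘(ℝ, V) (𝓘(ℝ, V).prod 𝓘(ℝ, V)) ∞
    (fun x ↦ (⟨x, X x⟩ : TangentBundle 𝓘(ℝ, V) M)) s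

/-- `X` is a smooth vector field, `X ∈ Γ(TM)`. -/
def SmoothField (X : Π x : M, TangentSpace 𝓘(ℝ, V) x) : Prop :=
  ContMDiff 𝓘(ℝ, V) (𝓘(ℝ, V).prod 𝓘(ℝ, V)) ∞
    (fun x ↦ (⟨x, X x⟩ : TangentBundle 𝓘(ℝ, V) M))

/-- `X ∈ Γ(D)`: a smooth vector field with values in the field of subspaces `D`. -/
def SmoothSection (D : Π x : M, Submodule ℝ (TangentSpace 𝓘(ℝ, V) x))
    (X : Π x : M, TangentSpace 𝓘(ℝ, V) x) : Prop :=
  SmoothField X ∧ ∀ x, X x ∈ D x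

/-- A (smooth) distribution, i.e. a smooth vector subbundle of the tangent bundle: around every
point there is a smooth local frame. -/
def IsDistribution (D : Π x : M, Submodule ℝ (TangentSpace 𝓘(ℝ, V) x)) : Prop :=
  ∀ p : M, ∃ U : Set M, IsOpen U ∧ p ∈ U ∧
    ∃ (k : ℕ) (X : Fin k → Π x : M, TangentSpace 𝓘(ℝ, V) x),
      (∀ i, SmoothFieldOn (X i) U) ∧
      ∀ x ∈ U, LinearIndependent ℝ (fun i ↦ X i x) ∧
        Submodule.span ℝ (Set.range fun i ↦ X i x) = D x

variable (W) in
/-- The vertical space `ker F_*` at `x`. -/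
def vertical (F : M → N) (x : M) : Submodule ℝ (TangentSpace 𝓘(ℝ, V) x) :=
  LinearMap.ker (mfderiv 𝓘(ℝ, V) 𝓘(ℝ, W) F x).toLinearMap

section Riemannian

variable [RiemannianBundle (fun x : M ↦ TangentSpace 𝓘(ℝ, V) x)]
  [IsContMDiffRiemannianBundle 𝓘(ℝ, V) ∞ V (fun x : M ↦ TangentSpace 𝓘(ℝ, V) x)]

/-- The tangent spaces are finite-dimensional. -/
instance tangentSpace_finiteDimensional (x : M) :
    FiniteDimensional ℝ (TangentSpace 𝓘(ℝ, V) x) :=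
  inferInstanceAs (FiniteDimensional ℝ V)

/-- `cov` is the Levi-Civita connection of the Riemannian metric: it is compatible with the metric
and torsion-free. -/
structure IsLeviCivita
    (cov : CovariantDerivative 𝓘(ℝ, V) V (fun x : M ↦ TangentSpace 𝓘(ℝ, V) x)) : Prop where
  metric : ∀ (x : M) (v : TangentSpace 𝓘(ℝ, V) x) (Y Z : Π x : M, TangentSpace 𝓘(ℝ, V) x),
    MDifferentiableAt 𝓘(ℝ, V) (𝓘(ℝ, V).prod 𝓘(ℝ, V))
      (fun y ↦ (⟨y, Y y⟩ : TangentBundle 𝓘(ℝ, V) M)) x →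
    MDifferentiableAt 𝓘(ℝ, V) (𝓘(ℝ, V).prod 𝓘(ℝ, V))
      (fun y ↦ (⟨y, Z y⟩ : TangentBundle 𝓘(ℝ, V) M)) x →
    mvfderiv 𝓘(ℝ, V) (fun y ↦ inner ℝ (Y y) (Z y)) x v =
      inner ℝ (cov Y x v) (Z x) + inner ℝ (Y x) (cov Z x v)
  torsion_free : haveI : CompleteSpace V := FiniteDimensional.complete ℝ V
    cov.torsion = 0

/-- An almost Hermitian structure: a smooth tensor field `J` of type `(1,1)` with `J² = -1` which
preserves the Riemannian metric. -/
structure IsAlmostHermitian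
    (J : Π x : M, TangentSpace 𝓘(ℝ, V) x →L[ℝ] TangentSpace 𝓘(ℝ, V) x) : Prop where
  smooth : ContMDiff 𝓘(ℝ, V)
    (𝓘(ℝ, V).prod 𝓘(ℝ, V →L[ℝ] V)) ∞
    (fun x ↦ TotalSpace.mk' (V →L[ℝ] V)
      (E := fun x : M ↦ TangentSpace 𝓘(ℝ, V) x →L[ℝ] TangentSpace 𝓘(ℝ, V) x) x (J x))
  sq : ∀ (x : M) (v : TangentSpace 𝓘(ℝ, V) x), J x (J x v) = -v
  isometry : ∀ (x : M) (v w : TangentSpace 𝓘(ℝ, V) x), inner ℝ (J x v) (J x w) = inner ℝ v w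

/-- A Kähler structure: an almost Hermitian structure `J` which is parallel,
`(∇_X J) Y = ∇_X (J Y) - J (∇_X Y) = 0`. Here `cov Y x v` is `∇_v Y` at `x`. -/
structure IsKahler
    (cov : CovariantDerivative 𝓘(ℝ, V) V (fun x : M ↦ TangentSpace 𝓘(ℝ, V) x))
    (J : Π x : M, TangentSpace 𝓘(ℝ, V) x →L[ℝ] TangentSpace 𝓘(ℝ, V) x) : Prop
    extends IsAlmostHermitian J where
  parallel : ∀ Y : Π x : M, TangentSpace 𝓘(ℝ, V) x, SmoothField Y →
    ∀ (x : M) (v : TangentSpace 𝓘(ℝ, V) x), cov (fun y ↦ J y (Y y)) x v = J x (cov Y x v)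

variable (W) in
/-- The horizontal space `(ker F_*)ᗮ` at `x`. -/
def horizontal (F : M → N) (x : M) : Submodule ℝ (TangentSpace 𝓘(ℝ, V) x) :=
  (vertical W F x)ᗮ

variable (W) in
/-- The vertical part `𝒱E` of a vector field. -/
def vertPart (F : M → N) (E : Π x : M, TangentSpace 𝓘(ℝ, V) x) : Π x : M, TangentSpace 𝓘(ℝ, V) x :=
  fun x ↦ (vertical W F x).starProjection (E x)

variable (W) in
/-- The horizontal part `ℋE` of a vector field. -/
def horPart (F : M → N) (E : Π x : M, TangentSpace 𝓘(ℝ, V) x) : Π x : M, TangentSpace 𝓘(ℝ, V) x :=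
  fun x ↦ (horizontal W F x).starProjection (E x)

variable (W) in
/-- O'Neill's tensor `𝒯_E G = ℋ ∇_{𝒱E} (𝒱G) + 𝒱 ∇_{𝒱E} (ℋG)` on vector fields `E`, `G`. -/
def oneillT
    (cov : CovariantDerivative 𝓘(ℝ, V) V (fun x : M ↦ TangentSpace 𝓘(ℝ, V) x))
    (F : M → N) (E G : Π x : M, TangentSpace 𝓘(ℝ, V) x) : Π x : M, TangentSpace 𝓘(ℝ, V) x :=
  horPart W F (fun x ↦ cov (vertPart W F G) x (vertPart W F E x)) +
    vertPart W F (fun x ↦ cov (horPart W F G) x (vertPart W F E x))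

variable (W) in
/-- O'Neill's tensor `𝒯` on tangent vectors `u`, `v` at `x`: its value on vector fields extending
`u` and `v`. -/
def oneillTAt
    (cov : CovariantDerivative 𝓘(ℝ, V) V (fun x : M ↦ TangentSpace 𝓘(ℝ, V) x))
    (F : M → N) (x : M) (u v : TangentSpace 𝓘(ℝ, V) x) : TangentSpace 𝓘(ℝ, V) x :=
  oneillT W cov F (FiberBundle.extend V u) (FiberBundle.extend V v) x

variable (W) in
/-- The mean curvature vector field `H` of the fibers of `F`: at `x` it is `(1/r) ∑ᵢ 𝒯(eᵢ, eᵢ)`,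
where `e₁, …, e_r` is an orthonormal basis of the tangent space `ker F_*` of the fiber through `x`
(on vertical vectors `𝒯` is the second fundamental form of the fiber). -/
def meanCurvature
    (cov : CovariantDerivative 𝓘(ℝ, V) V (fun x : M ↦ TangentSpace 𝓘(ℝ, V) x))
    (F : M → N) (x : M) : TangentSpace 𝓘(ℝ, V) x :=
  normalizedTrace (vertical W F x) (oneillTAt W cov F x)

variable (W) in
/-- `F` has totally umbilical fibers: `𝒯_X Y = g(X, Y) H` for all `X, Y ∈ Γ(ker F_*)`. -/
def HasTotallyUmbilicalFibers
    (cov : CovariantDerivative 𝓘(ℝ, V) V (fun x : M ↦ TangentSpace 𝓘(ℝ, V) x))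
    (F : M → N) : Prop :=
  ∀ X Y : Π x : M, TangentSpace 𝓘(ℝ, V) x,
    SmoothSection (vertical W F) X → SmoothSection (vertical W F) Y →
    ∀ x, oneillT W cov F X Y x = inner ℝ (X x) (Y x) • meanCurvature W cov F x

variable (W) in
/-- `𝒟₂`, the orthogonal complement of `𝒟₁` in `ker F_*`. -/
def compl (F : M → N) (D₁ : Π x : M, Submodule ℝ (TangentSpace 𝓘(ℝ, V) x)) (x : M) :
    Submodule ℝ (TangentSpace 𝓘(ℝ, V) x) :=
  vertical W F x ⊓ (D₁ x)ᗮ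

variable (W) in
/-- `J𝒟₂`. -/
def JD₂ (F : M → N) (J : Π x : M, TangentSpace 𝓘(ℝ, V) x →L[ℝ] TangentSpace 𝓘(ℝ, V) x)
    (D₁ : Π x : M, Submodule ℝ (TangentSpace 𝓘(ℝ, V) x)) (x : M) :
    Submodule ℝ (TangentSpace 𝓘(ℝ, V) x) :=
  (compl W F D₁ x).map (J x).toLinearMap

variable (W) in
/-- `μ`, the orthogonal complement of `J𝒟₂` in `(ker F_*)ᗮ`. -/
def mu (F : M → N) (J : Π x : M, TangentSpace 𝓘(ℝ, V) x →L[ℝ] TangentSpace 𝓘(ℝ, V) x)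
    (D₁ : Π x : M, Submodule ℝ (TangentSpace 𝓘(ℝ, V) x)) (x : M) :
    Submodule ℝ (TangentSpace 𝓘(ℝ, V) x) :=
  horizontal W F x ⊓ (JD₂ W F J D₁ x)ᗮ

variable [RiemannianBundle (fun y : N ↦ TangentSpace 𝓘(ℝ, W) y)]

variable (V W) in
/-- A Riemannian submersion: a smooth surjective map of maximal rank whose differential is
isometric on horizontal vectors. -/
structure IsRiemannianSubmersion (F : M → N) : Prop where
  smooth : ContMDiff 𝓘(ℝ, V) 𝓘(ℝ, W) ∞ F
  surjective : Function.Surjective F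
  maximal_rank : ∀ x, Function.Surjective (mfderiv 𝓘(ℝ, V) 𝓘(ℝ, W) F x)
  isometry : ∀ x, ∀ u ∈ horizontal W F x, ∀ v ∈ horizontal W F x,
    inner ℝ (mfderiv 𝓘(ℝ, V) 𝓘(ℝ, W) F x u) (mfderiv 𝓘(ℝ, V) 𝓘(ℝ, W) F x v) = inner ℝ u v

variable (W) in
/-- `F` is a semi-invariant Riemannian submersion with invariant distribution `𝒟₁`:
`𝒟₁ ⊆ ker F_*`, `J𝒟₁ = 𝒟₁`, and `J𝒟₂ ⊆ (ker F_*)ᗮ` for the orthogonal complement `𝒟₂` of `𝒟₁`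
in `ker F_*`. -/
structure IsSemiInvariant (F : M → N)
    (J : Π x : M, TangentSpace 𝓘(ℝ, V) x →L[ℝ] TangentSpace 𝓘(ℝ, V) x)
    (D₁ : Π x : M, Submodule ℝ (TangentSpace 𝓘(ℝ, V) x)) : Prop
    extends IsRiemannianSubmersion V W F where
  distribution : IsDistribution D₁
  le_vertical : ∀ x, D₁ x ≤ vertical W F x
  invariant : ∀ x, (D₁ x).map (J x).toLinearMap = D₁ x
  antiInvariant : ∀ x, JD₂ W F J D₁ x ≤ horizontal W F x

end Riemannian

end

end SemiInvariantSubmersion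

/-! Near a point `p`, choose a section `X` of `𝒟₁` with `X p ≠ 0`. Both `X` and `JX` are vertical
and `g(X, JX) = 0`, so umbilicity gives `ℋ∇_X(JX) = 𝒯_X(JX) = 0`. Since `∇J = 0`, this says that
`J(∇_X X)` is vertical. Writing `J(∇_X X) = w₁ + w₂` along `𝒟₁ ⊕ 𝒟₂` and applying `-J`, the vector
`∇_X X` is the sum of `-Jw₁`, which is vertical, and `-Jw₂ ∈ J𝒟₂`, which is horizontal. Hence `|X|²
H = ℋ∇_X X` lies in `J𝒟₂` (`IsSemiInvariant.starProjection_mem_JD₂`,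
`IsSemiInvariant.meanCurvature_mem_JD₂`).

Smoothness of `H` comes from the same formula, once `∇_X X` and its horizontal part are known to be
smooth. Both are tested against smooth fields `Z` (`smoothField_of_inner`): `g(∇_X X, Z)` is smooth
by Koszul's formula, and `g₁(ℋE, Z) = g₂(F_*E, F_*Z)` because `F` is a Riemannian submersion. -/

namespace SemiInvariantSubmersion

open VectorField Filter

set_option linter.unusedSectionVars false

/-! ### Smoothness of vector fields, tested by inner products -/

section Frames

variable
  {V : Type*} [NormedAddCommGroup V] [NormedSpace ℝ V] [FiniteDimensional ℝ V]
  {M : Type*} [TopologicalSpace M] [ChartedSpace V M] [IsManifold 𝓘(ℝ, V) ∞ M]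

/-- A smooth local vector field can be cut off to a global one, without changing it near a given
point. -/
theorem exists_smoothField_smul [T2Space M] {U : Set M} (hU : IsOpen U) {p : M}
    (hp : p ∈ U) : ∃ ψ : M → ℝ, ψ =ᶠ[𝓝 p] 1 ∧ (∀ x ∉ U, ψ x = 0) ∧
      ∀ X : Π x : M, TangentSpace 𝓘(ℝ, V) x, SmoothFieldOn X U → SmoothField (ψ • X) := by
  obtain ⟨ψ, hψ⟩ :=
    (SmoothBumpFunction.nhds_basis_support (I := 𝓘(ℝ, V)) (hU.mem_nhds hp)).ex_mem
  refine ⟨ψ, ψ.eventuallyEq_one, fun x hx ↦ ?_, fun X hX ↦ ?_⟩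
  · exact image_eq_zero_of_notMem_tsupport fun h ↦ hx (hψ h)
  · exact ContMDiffOn.smul_section_of_tsupport ψ.contMDiff.contMDiffOn hU hψ hX

variable [RiemannianBundle (fun x : M ↦ TangentSpace 𝓘(ℝ, V) x)]
  [IsContMDiffRiemannianBundle 𝓘(ℝ, V) ∞ V (fun x : M ↦ TangentSpace 𝓘(ℝ, V) x)]

/-- The product of two smooth vector fields is smooth. -/
theorem contMDiffAt_inner {X Y : Π x : M, TangentSpace 𝓘(ℝ, V) x} {p : M}
    (hX : ContMDiffAt 𝓘(ℝ, V) (𝓘(ℝ, V).prod 𝓘(ℝ, V)) ∞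
      (fun x ↦ (⟨x, X x⟩ : TangentBundle 𝓘(ℝ, V) M)) p)
    (hY : ContMDiffAt 𝓘(ℝ, V) (𝓘(ℝ, V).prod 𝓘(ℝ, V)) ∞
      (fun x ↦ (⟨x, Y x⟩ : TangentBundle 𝓘(ℝ, V) M)) p) :
    ContMDiffAt 𝓘(ℝ, V) 𝓘(ℝ) ∞ (fun x ↦ inner ℝ (X x) (Y x)) p :=
  ContMDiffAt.inner_bundle (IB := 𝓘(ℝ, V)) (F := V) (E := fun x : M ↦ TangentSpace 𝓘(ℝ, V) x)
    (b := fun x ↦ x) hX hY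

/-- The Gram-Schmidt process preserves smoothness of vector fields, and smoothness of their
products with a given field `A`. -/
theorem contMDiffAt_gramSchmidt {k : ℕ} {f : Fin k → Π x : M, TangentSpace 𝓘(ℝ, V) x} {p : M}
    {A : Π x : M, TangentSpace 𝓘(ℝ, V) x}
    (hf : ∀ i, ContMDiffAt 𝓘(ℝ, V) (𝓘(ℝ, V).prod 𝓘(ℝ, V)) ∞
      (fun x ↦ (⟨x, f i x⟩ : TangentBundle 𝓘(ℝ, V) M)) p)
    (hA : ∀ i, ContMDiffAt 𝓘(ℝ, V) 𝓘(ℝ) ∞ (fun x ↦ inner ℝ (f i x) (A x)) p)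
    (hli : LinearIndependent ℝ (fun i ↦ f i p)) (i : Fin k) :
    ContMDiffAt 𝓘(ℝ, V) (𝓘(ℝ, V).prod 𝓘(ℝ, V)) ∞
      (fun x ↦ (⟨x, InnerProductSpace.gramSchmidt ℝ (fun j ↦ f j x) i⟩ :
        TangentBundle 𝓘(ℝ, V) M)) p ∧
    ContMDiffAt 𝓘(ℝ, V) 𝓘(ℝ) ∞
      (fun x ↦ inner ℝ (InnerProductSpace.gramSchmidt ℝ (fun j ↦ f j x) i) (A x)) p := by
  induction i using WellFoundedLT.induction with
  | ind i ih =>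
    let g : Fin k → Π x : M, TangentSpace 𝓘(ℝ, V) x :=
      fun i x ↦ InnerProductSpace.gramSchmidt ℝ (fun j ↦ f j x) i
    let c : Fin k → M → ℝ := fun j x ↦ inner ℝ (g j x) (f i x) / inner ℝ (g j x) (g j x)
    -- This holds even where some `g j x` vanishes, division by zero being zero; nonvanishing is
    -- needed only at `p`, for smoothness of the `c j`.
    have hg : ∀ x, g i x = f i x - ∑ j ∈ Finset.Iio i, c j x • g j x := by
      intro x
      simp only [g, c]
      rw [InnerProductSpace.gramSchmidt_def]
      simp only [Submodule.starProjection_singleton, real_inner_self_eq_norm_sq]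
      rfl
    have hc : ∀ j ∈ Finset.Iio i, ContMDiffAt 𝓘(ℝ, V) 𝓘(ℝ) ∞ (c j) p := by
      intro j hj
      have hj' := (ih j (Finset.mem_Iio.1 hj)).1
      refine (contMDiffAt_inner hj' (hf i)).div₀ (contMDiffAt_inner hj' hj') ?_
      exact inner_self_ne_zero.2 (InnerProductSpace.gramSchmidt_ne_zero j hli)
    constructor
    · have := (hf i).sub_section (ContMDiffAt.sum_section (s := Finset.Iio i)
        (t := fun j x ↦ c j x • g j x)
        fun j hj ↦ (hc j hj).smul_section (ih j (Finset.mem_Iio.1 hj)).1)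
      refine this.congr_of_eventuallyEq (Eventually.of_forall fun x ↦ ?_)
      exact congrArg (fun v ↦ (⟨x, v⟩ : TangentBundle 𝓘(ℝ, V) M)) (hg x)
    · have : ContMDiffAt 𝓘(ℝ, V) 𝓘(ℝ) ∞ (fun x ↦ inner ℝ (f i x) (A x) -
          ∑ j ∈ Finset.Iio i, c j x * inner ℝ (g j x) (A x)) p :=
        (hA i).sub (ContMDiffAt.sum fun j hj ↦ (hc j hj).mul (ih j (Finset.mem_Iio.1 hj)).2)
      refine this.congr_of_eventuallyEq (Eventually.of_forall fun x ↦ ?_)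
      change inner ℝ (g i x) (A x) = _
      rw [hg x]
      simp only [inner_sub_left, sum_inner, real_inner_smul_left]

/-- A vector field is smooth as soon as its products with all smooth vector fields are. -/
theorem smoothField_of_inner [T2Space M] {A : Π x : M, TangentSpace 𝓘(ℝ, V) x}
    (hA : ∀ Z : Π x : M, TangentSpace 𝓘(ℝ, V) x, SmoothField Z →
      ContMDiff 𝓘(ℝ, V) 𝓘(ℝ) ∞ (fun x ↦ inner ℝ (Z x) (A x))) : SmoothField A := by
  intro p
  let e := trivializationAt V (TangentSpace 𝓘(ℝ, V) : M → Type _) p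
  let b := finBasis ℝ V
  have hpe : p ∈ e.baseSet := FiberBundle.mem_baseSet_trivializationAt' p
  obtain ⟨ψ, hψ1, -, hψ⟩ :=
    exists_smoothField_smul (V := V) e.open_baseSet hpe
  -- The cutoff is needed because `hA` tests only against global fields; near `p` the `f i` still
  -- form a frame.
  let f : Fin (finrank ℝ V) → Π x : M, TangentSpace 𝓘(ℝ, V) x := fun i ↦ ψ • e.localFrame b i
  have hfs : ∀ i, SmoothField (f i) := fun i ↦
    hψ _ (e.contMDiffOn_localFrame_baseSet ∞ b i)
  have hfr := e.isLocalFrameOn_localFrame_baseSet (I := 𝓘(ℝ, V)) (n := ∞) (b := b)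
  have hli : ∀ᶠ x in 𝓝 p, LinearIndependent ℝ (fun i ↦ f i x) := by
    filter_upwards [hψ1, e.open_baseSet.mem_nhds hpe] with x hx hxe
    have : (fun i ↦ f i x) = fun i ↦ e.localFrame b i x := by
      funext i; simp [f, hx]
    rw [this]
    exact hfr.linearIndependent hxe
  have hgs := contMDiffAt_gramSchmidt (p := p) (A := A) (fun i ↦ hfs i p) (fun i ↦ hA _ (hfs i) p)
    hli.self_of_nhds
  let g : Fin (finrank ℝ V) → Π x : M, TangentSpace 𝓘(ℝ, V) x :=
    fun i x ↦ InnerProductSpace.gramSchmidt ℝ (fun j ↦ f j x) i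
  -- Coefficients of `A` in the orthogonal frame `g`. Without normalization, no square roots have to
  -- be shown smooth.
  let c : Fin (finrank ℝ V) → M → ℝ := fun i x ↦ inner ℝ (g i x) (A x) / inner ℝ (g i x) (g i x)
  have hc : ∀ i, ContMDiffAt 𝓘(ℝ, V) 𝓘(ℝ) ∞ (c i) p := fun i ↦
    (hgs i).2.div₀ (contMDiffAt_inner (hgs i).1 (hgs i).1)
      (inner_self_ne_zero.2 (InnerProductSpace.gramSchmidt_ne_zero i hli.self_of_nhds))
  have hsum := ContMDiffAt.sum_section (s := Finset.univ) (t := fun i x ↦ c i x • g i x)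
    fun i _ ↦ (hc i).smul_section (hgs i).1
  refine hsum.congr_of_eventuallyEq ?_
  filter_upwards [hli] with x hx
  refine congrArg (fun v ↦ (⟨x, v⟩ : TangentBundle 𝓘(ℝ, V) M)) ?_
  have hcard : finrank ℝ (TangentSpace 𝓘(ℝ, V) x) = Fintype.card (Fin (finrank ℝ V)) := by
    rw [Fintype.card_fin]; rfl
  let B := InnerProductSpace.gramSchmidtOrthonormalBasis hcard (fun j ↦ f j x)
  have hB : ∀ i, B i = ‖g i x‖⁻¹ • g i x := by
    intro i
    have h0 : InnerProductSpace.gramSchmidtNormed ℝ (fun j ↦ f j x) i ≠ 0 := by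
      intro h
      have := InnerProductSpace.gramSchmidtNormed_unit_length i hx
      rw [h, norm_zero] at this
      exact zero_ne_one this
    exact InnerProductSpace.gramSchmidtOrthonormalBasis_apply hcard h0
  conv_lhs => rw [← B.sum_repr' (A x)]
  refine Finset.sum_congr rfl fun i _ ↦ ?_
  rw [hB, real_inner_smul_left, smul_smul]
  congr 1
  simp only [c, real_inner_self_eq_norm_sq]
  rw [div_eq_mul_inv, pow_two, mul_inv]
  ring

end Frames

/-! ### The Levi-Civita connection and the complex structure -/

section LeviCivita

variable
  {V : Type*} [NormedAddCommGroup V] [NormedSpace ℝ V] [FiniteDimensional ℝ V]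
  {M : Type*} [TopologicalSpace M] [ChartedSpace V M] [IsManifold 𝓘(ℝ, V) ∞ M]
  {X Y Z : Π x : M, TangentSpace 𝓘(ℝ, V) x}

theorem SmoothField.mdifferentiableAt (hX : SmoothField X) (p : M) :
    MDifferentiableAt 𝓘(ℝ, V) (𝓘(ℝ, V).prod 𝓘(ℝ, V))
      (fun y ↦ (⟨y, X y⟩ : TangentBundle 𝓘(ℝ, V) M)) p :=
  ContMDiff.mdifferentiable hX (by simp) p

/-- The derivative of a smooth function along a smooth vector field is smooth. -/
theorem SmoothField.contMDiff_mvfderiv (hX : SmoothField X) {f : M → ℝ}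
    (hf : ContMDiff 𝓘(ℝ, V) 𝓘(ℝ) ∞ f) :
    ContMDiff 𝓘(ℝ, V) 𝓘(ℝ) ∞ (fun x ↦ mvfderiv 𝓘(ℝ, V) f x (X x)) :=
  (contMDiff_snd_tangentBundle_modelSpace ℝ 𝓘(ℝ)).comp
    ((hf.contMDiff_tangentMap (m := ∞) (by simp)).comp hX)

theorem SmoothField.mlieBracket (hX : SmoothField X) (hY : SmoothField Y) :
    SmoothField (mlieBracket 𝓘(ℝ, V) X Y) := by
  have : CompleteSpace V := FiniteDimensional.complete ℝ V
  have : IsManifold 𝓘(ℝ, V) (((⊤ : ℕ∞) : ℕ∞ω) + 1) M := ‹IsManifold 𝓘(ℝ, V) ∞ M›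
  have : IsManifold 𝓘(ℝ, V) (minSmoothness ℝ 2) M := by
    rw [minSmoothness_of_isRCLikeNormedField]
    infer_instance
  exact ContDiff.mlieBracket_vectorField (m := ⊤) (n := ⊤) hX hY (by simp)

variable [RiemannianBundle (fun x : M ↦ TangentSpace 𝓘(ℝ, V) x)]
  [IsContMDiffRiemannianBundle 𝓘(ℝ, V) ∞ V (fun x : M ↦ TangentSpace 𝓘(ℝ, V) x)]

theorem SmoothField.inner (hX : SmoothField X) (hY : SmoothField Y) :
    ContMDiff 𝓘(ℝ, V) 𝓘(ℝ) ∞ (fun x ↦ inner ℝ (X x) (Y x)) :=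
  fun x ↦ contMDiffAt_inner (hX x) (hY x)

/-- The Koszul formula for `g(∇_X X, Z)`. -/
theorem IsLeviCivita.inner_cov_self
    {cov : CovariantDerivative 𝓘(ℝ, V) V (fun x : M ↦ TangentSpace 𝓘(ℝ, V) x)}
    (hcov : IsLeviCivita cov) (hX : SmoothField X) (hZ : SmoothField Z) (p : M) :
    inner ℝ (Z p) (cov X p (X p)) =
      mvfderiv 𝓘(ℝ, V) (fun y ↦ inner ℝ (X y) (Z y)) p (X p) -
        inner ℝ (X p) (mlieBracket 𝓘(ℝ, V) X Z p) -
        2⁻¹ * mvfderiv 𝓘(ℝ, V) (fun y ↦ inner ℝ (X y) (X y)) p (Z p) := by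
  have : CompleteSpace V := FiniteDimensional.complete ℝ V
  -- Combine `g(∇_X X, Z) = X g(X, Z) - g(X, ∇_X Z)`, `∇_X Z = [X, Z] + ∇_Z X` and `g(X, ∇_Z X) = ½
  -- Z g(X, X)`.
  have h1 := hcov.metric p (X p) X Z (hX.mdifferentiableAt p) (hZ.mdifferentiableAt p)
  have h2 := hcov.metric p (Z p) X X (hX.mdifferentiableAt p) (hX.mdifferentiableAt p)
  have h3 := cov.torsion_eq_zero_iff.1 hcov.torsion_free
    (hX.mdifferentiableAt p) (hZ.mdifferentiableAt p)
  rw [h1, h2, ← h3, inner_sub_right, real_inner_comm (cov X p (X p)),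
    real_inner_comm (X p) (cov X p (Z p))]
  ring

/-- Every term of the Koszul formula is smooth in the base point, so the inner products with smooth
fields are smooth. -/
theorem IsLeviCivita.smoothField_cov_self [T2Space M]
    {cov : CovariantDerivative 𝓘(ℝ, V) V (fun x : M ↦ TangentSpace 𝓘(ℝ, V) x)}
    (hcov : IsLeviCivita cov) (hX : SmoothField X) :
    SmoothField (fun x ↦ cov X x (X x)) := by
  refine smoothField_of_inner fun Z hZ ↦ ?_
  simp only [hcov.inner_cov_self hX hZ]
  exact ((hX.contMDiff_mvfderiv (hX.inner hZ)).sub (hX.inner (hX.mlieBracket hZ))).sub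
    (contMDiff_const.mul (hZ.contMDiff_mvfderiv (hX.inner hX)))

theorem IsAlmostHermitian.smoothField
    {J : Π x : M, TangentSpace 𝓘(ℝ, V) x →L[ℝ] TangentSpace 𝓘(ℝ, V) x}
    (hJ : IsAlmostHermitian J) (hX : SmoothField X) : SmoothField (fun x ↦ J x (X x)) :=
  ContMDiff.clm_bundle_apply (F₁ := V) (F₂ := V)
    (E₁ := fun x : M ↦ TangentSpace 𝓘(ℝ, V) x) (E₂ := fun x : M ↦ TangentSpace 𝓘(ℝ, V) x)
    (b := fun x ↦ x) hJ.smooth hX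

/-- `J` is skew: `g(v, Jv) = g(Jv, J²v) = -g(Jv, v)`. -/
theorem IsAlmostHermitian.inner_self_apply
    {J : Π x : M, TangentSpace 𝓘(ℝ, V) x →L[ℝ] TangentSpace 𝓘(ℝ, V) x}
    (hJ : IsAlmostHermitian J) {x : M} (v : TangentSpace 𝓘(ℝ, V) x) : inner ℝ v (J x v) = 0 := by
  have h := hJ.isometry x v (J x v)
  rw [hJ.sq, inner_neg_right, real_inner_comm] at h
  linarith

end LeviCivita

/-! ### Riemannian submersions and the mean curvature of the fibers -/

section Submersion

variable
  {V : Type*} [NormedAddCommGroup V] [NormedSpace ℝ V] [FiniteDimensional ℝ V]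
  {W : Type*} [NormedAddCommGroup W] [NormedSpace ℝ W]
  {M : Type*} [TopologicalSpace M] [ChartedSpace V M] [IsManifold 𝓘(ℝ, V) ∞ M]
  [RiemannianBundle (fun x : M ↦ TangentSpace 𝓘(ℝ, V) x)]
  [IsContMDiffRiemannianBundle 𝓘(ℝ, V) ∞ V (fun x : M ↦ TangentSpace 𝓘(ℝ, V) x)]
  {N : Type*} [TopologicalSpace N] [ChartedSpace W N]
  {F : M → N} {X Y Z : Π x : M, TangentSpace 𝓘(ℝ, V) x}

theorem starProjection_horizontal {x : M} (v : TangentSpace 𝓘(ℝ, V) x) :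
    (horizontal W F x).starProjection v = v - (vertical W F x).starProjection v :=
  Submodule.starProjection_orthogonal_val v

theorem starProjection_horizontal_of_mem_vertical {x : M} {v : TangentSpace 𝓘(ℝ, V) x}
    (hv : v ∈ vertical W F x) : (horizontal W F x).starProjection v = 0 := by
  rw [starProjection_horizontal, Submodule.starProjection_eq_self_iff.2 hv, sub_self]

theorem mfderiv_starProjection_horizontal {x : M} (v : TangentSpace 𝓘(ℝ, V) x) :
    mfderiv 𝓘(ℝ, V) 𝓘(ℝ, W) F x ((horizontal W F x).starProjection v) =
      mfderiv 𝓘(ℝ, V) 𝓘(ℝ, W) F x v := by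
  have h : (vertical W F x).starProjection v ∈ vertical W F x :=
    Submodule.starProjection_apply_mem _ _
  rw [starProjection_horizontal, map_sub]
  exact sub_eq_self.2 h

/-- On vertical fields, `𝒯_X Y` is the horizontal part of `∇_X Y`. -/
theorem oneillT_of_mem_vertical
    (cov : CovariantDerivative 𝓘(ℝ, V) V (fun x : M ↦ TangentSpace 𝓘(ℝ, V) x))
    (hX : ∀ x, X x ∈ vertical W F x) (hY : ∀ x, Y x ∈ vertical W F x) (x : M) :
    oneillT W cov F X Y x = (horizontal W F x).starProjection (cov Y x (X x)) := by
  have vX : vertPart W F X = X := funext fun y ↦ Submodule.starProjection_eq_self_iff.2 (hX y)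
  have vY : vertPart W F Y = Y := funext fun y ↦ Submodule.starProjection_eq_self_iff.2 (hY y)
  have hY0 : horPart W F Y = 0 :=
    funext fun y ↦ starProjection_horizontal_of_mem_vertical (hY y)
  simp only [oneillT, vX, vY, hY0, CovariantDerivative.zero]
  simp [horPart, vertPart]

variable [IsManifold 𝓘(ℝ, W) ∞ N] [RiemannianBundle (fun y : N ↦ TangentSpace 𝓘(ℝ, W) y)]
  [IsContMDiffRiemannianBundle 𝓘(ℝ, W) ∞ W (fun y : N ↦ TangentSpace 𝓘(ℝ, W) y)]

/-- The horizontal part of a smooth vector field is smooth: `g₁(ℋX, Z) = g₂(F_* X, F_* Z)`. -/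
theorem IsRiemannianSubmersion.smoothField_horPart [T2Space M]
    (hF : IsRiemannianSubmersion V W F) (hX : SmoothField X) : SmoothField (horPart W F X) := by
  refine smoothField_of_inner fun Z hZ ↦ ?_
  have key : ∀ x, inner ℝ (Z x) (horPart W F X x) =
      inner ℝ (mfderiv 𝓘(ℝ, V) 𝓘(ℝ, W) F x (Z x))
        (mfderiv 𝓘(ℝ, V) 𝓘(ℝ, W) F x (X x)) := by
    intro x
    have h := hF.isometry x _ (Submodule.starProjection_apply_mem (horizontal W F x) (Z x))
      _ (Submodule.starProjection_apply_mem (horizontal W F x) (X x))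
    rw [mfderiv_starProjection_horizontal, mfderiv_starProjection_horizontal] at h
    -- The projection is self-adjoint and idempotent, so `g(ℋZ, ℋX) = g(Z, ℋX)`.
    rw [h, Submodule.inner_starProjection_left_eq_right,
      Submodule.starProjection_eq_self_iff.2 (Submodule.starProjection_apply_mem _ _)]
    rfl
  simp only [key]
  have hT := hF.smooth.contMDiff_tangentMap (m := ∞) (by simp)
  exact ContMDiff.inner_bundle (IB := 𝓘(ℝ, W)) (F := W)
    (E := fun y : N ↦ TangentSpace 𝓘(ℝ, W) y) (b := F) (hT.comp hZ) (hT.comp hX)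

/-- A distribution has a section which does not vanish at a given point where its rank is positive. -/
theorem IsDistribution.exists_smoothSection [T2Space M]
    {D : Π x : M, Submodule ℝ (TangentSpace 𝓘(ℝ, V) x)} (hD : IsDistribution D) {p : M}
    (hp : D p ≠ ⊥) : ∃ X, SmoothSection D X ∧ X p ≠ 0 := by
  obtain ⟨U, hU, hpU, k, X, hX, hspan⟩ := hD p
  obtain ⟨i, hi⟩ : ∃ i, X i p ≠ 0 := by
    by_contra! h
    refine hp ?_
    rw [← (hspan p hpU).2, Submodule.span_eq_bot]
    rintro _ ⟨i, rfl⟩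
    exact h i
  obtain ⟨ψ, hψ1, hψ0, hψ⟩ := exists_smoothField_smul (V := V) hU hpU
  refine ⟨ψ • X i, ⟨hψ _ (hX i), fun x ↦ ?_⟩, ?_⟩
  · by_cases hx : x ∈ U
    · refine Submodule.smul_mem _ _ ?_
      rw [← (hspan x hx).2]
      exact Submodule.subset_span ⟨i, rfl⟩
    · simp [hψ0 x hx]
  · simpa [hψ1.self_of_nhds] using hi

/-- For totally umbilical fibers, `|X|² H = ℋ ∇_X X` for vertical `X`. -/
theorem HasTotallyUmbilicalFibers.meanCurvature_eq
    {cov : CovariantDerivative 𝓘(ℝ, V) V (fun x : M ↦ TangentSpace 𝓘(ℝ, V) x)}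
    (h : HasTotallyUmbilicalFibers W cov F) (hX : SmoothSection (vertical W F) X) {x : M}
    (hx : X x ≠ 0) :
    meanCurvature W cov F x =
      (inner ℝ (X x) (X x))⁻¹ • horPart W F (fun y ↦ cov X y (X y)) x := by
  have h1 := h X X hX hX x
  rw [oneillT_of_mem_vertical cov hX.2 hX.2] at h1
  exact (eq_inv_smul_iff₀ (inner_self_ne_zero.2 hx)).2 h1.symm

/-- A vector whose image under `J` is vertical has its horizontal part in `J𝒟₂`. -/
theorem IsSemiInvariant.starProjection_mem_JD₂
    {J : Π x : M, TangentSpace 𝓘(ℝ, V) x →L[ℝ] TangentSpace 𝓘(ℝ, V) x}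
    {D₁ : Π x : M, Submodule ℝ (TangentSpace 𝓘(ℝ, V) x)} (hF : IsSemiInvariant W F J D₁)
    (hJ : IsAlmostHermitian J) {x : M} {u : TangentSpace 𝓘(ℝ, V) x}
    (hu : J x u ∈ vertical W F x) :
    (horizontal W F x).starProjection u ∈ JD₂ W F J D₁ x := by
  set w := J x u with hw
  set w₁ := (D₁ x).starProjection w
  have hw₁D : w₁ ∈ D₁ x := Submodule.starProjection_apply_mem _ _
  have hw₂ : w - w₁ ∈ compl W F D₁ x :=
    ⟨sub_mem hu (hF.le_vertical x hw₁D), Submodule.sub_starProjection_mem_orthogonal w⟩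
  have hJw₁ : J x w₁ ∈ vertical W F x :=
    hF.le_vertical x (hF.invariant x ▸ Submodule.mem_map_of_mem (f := (J x).toLinearMap) hw₁D)
  have hJw₂ : J x (w - w₁) ∈ JD₂ W F J D₁ x :=
    Submodule.mem_map_of_mem (f := (J x).toLinearMap) hw₂
  -- This is `u = -J(Ju)`, split along `𝒟₁ ⊕ 𝒟₂`.
  have hu' : u = -J x w₁ - J x (w - w₁) := by
    rw [map_sub, hw, hJ.sq]; abel
  rw [hu', map_sub, map_neg, starProjection_horizontal_of_mem_vertical hJw₁,
    Submodule.starProjection_eq_self_iff.2 (hF.antiInvariant x hJw₂), neg_zero, zero_sub]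
  exact neg_mem hJw₂

/-- Umbilicity is used twice: on `(X, JX)` it makes `J(∇_X X)` vertical, and on `(X, X)` it
identifies `H` with a multiple of `ℋ∇_X X`. -/
theorem IsSemiInvariant.meanCurvature_mem_JD₂ [T2Space M]
    {cov : CovariantDerivative 𝓘(ℝ, V) V (fun x : M ↦ TangentSpace 𝓘(ℝ, V) x)}
    {J : Π x : M, TangentSpace 𝓘(ℝ, V) x →L[ℝ] TangentSpace 𝓘(ℝ, V) x}
    {D₁ : Π x : M, Submodule ℝ (TangentSpace 𝓘(ℝ, V) x)} (hF : IsSemiInvariant W F J D₁)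
    (hJ : IsKahler cov J) (h : HasTotallyUmbilicalFibers W cov F) {x : M} (hx : D₁ x ≠ ⊥) :
    meanCurvature W cov F x ∈ JD₂ W F J D₁ x := by
  obtain ⟨X, hX, hXx⟩ := hF.distribution.exists_smoothSection hx
  have hXv : SmoothSection (vertical W F) X := ⟨hX.1, fun y ↦ hF.le_vertical y (hX.2 y)⟩
  have hJX : SmoothSection (vertical W F) (fun y ↦ J y (X y)) :=
    ⟨hJ.toIsAlmostHermitian.smoothField hX.1, fun y ↦ hF.le_vertical y
      (hF.invariant y ▸ Submodule.mem_map_of_mem (f := (J y).toLinearMap) (hX.2 y))⟩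
  have h1 := h X _ hXv hJX x
  rw [oneillT_of_mem_vertical cov hXv.2 hJX.2, hJ.toIsAlmostHermitian.inner_self_apply, zero_smul,
    hJ.parallel X hX.1, starProjection_horizontal, sub_eq_zero] at h1
  rw [h.meanCurvature_eq hXv hXx]
  exact Submodule.smul_mem _ _ (hF.starProjection_mem_JD₂ hJ.toIsAlmostHermitian
    (Submodule.starProjection_eq_self_iff.1 h1.symm))

/-- A vertical field with `X p ≠ 0` stays nonzero near `p`, where `H = |X|⁻² ℋ∇_X X` is a smooth
expression. This avoids choosing smooth orthonormal frames of the fibers. -/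
theorem IsRiemannianSubmersion.smoothField_meanCurvature [T2Space M]
    {cov : CovariantDerivative 𝓘(ℝ, V) V (fun x : M ↦ TangentSpace 𝓘(ℝ, V) x)}
    (hF : IsRiemannianSubmersion V W F) (hcov : IsLeviCivita cov)
    (h : HasTotallyUmbilicalFibers W cov F)
    (hex : ∀ p, ∃ X : Π x : M, TangentSpace 𝓘(ℝ, V) x,
      SmoothSection (vertical W F) X ∧ X p ≠ 0) :
    SmoothField (meanCurvature W cov F) := by
  intro p
  obtain ⟨X, hX, hXp⟩ := hex p
  have hs := hF.smoothField_horPart (hcov.smoothField_cov_self hX.1) p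
  have hc : ContMDiffAt 𝓘(ℝ, V) 𝓘(ℝ) ∞ (fun x ↦ inner ℝ (X x) (X x)) p := hX.1.inner hX.1 p
  have hne : (inner ℝ (X p) (X p) : ℝ) ≠ 0 := inner_self_ne_zero.2 hXp
  refine ((hc.inv₀ hne).smul_section hs).congr_of_eventuallyEq ?_
  filter_upwards [hc.continuousAt.eventually_ne hne] with x hx
  exact congrArg (fun v ↦ (⟨x, v⟩ : TangentBundle 𝓘(ℝ, V) M))
    (h.meanCurvature_eq hX (inner_self_ne_zero.1 hx))

end Submersion

end SemiInvariantSubmersion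

theorem lemma4p2
    {V : Type*} [NormedAddCommGroup V] [NormedSpace ℝ V] [FiniteDimensional ℝ V]
    {W : Type*} [NormedAddCommGroup W] [NormedSpace ℝ W] [FiniteDimensional ℝ W]
    {M₁ : Type*} [TopologicalSpace M₁] [T2Space M₁] [SecondCountableTopology M₁]
    [ChartedSpace V M₁] [IsManifold 𝓘(ℝ, V) ∞ M₁]
    [RiemannianBundle (fun x : M₁ ↦ TangentSpace 𝓘(ℝ, V) x)]
    [IsContMDiffRiemannianBundle 𝓘(ℝ, V) ∞ V (fun x : M₁ ↦ TangentSpace 𝓘(ℝ, V) x)]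
    {M₂ : Type*} [TopologicalSpace M₂] [T2Space M₂] [SecondCountableTopology M₂]
    [ChartedSpace W M₂] [IsManifold 𝓘(ℝ, W) ∞ M₂]
    [RiemannianBundle (fun y : M₂ ↦ TangentSpace 𝓘(ℝ, W) y)]
    [IsContMDiffRiemannianBundle 𝓘(ℝ, W) ∞ W (fun y : M₂ ↦ TangentSpace 𝓘(ℝ, W) y)]
    (cov : CovariantDerivative 𝓘(ℝ, V) V (fun x : M₁ ↦ TangentSpace 𝓘(ℝ, V) x))
    (hcov : SemiInvariantSubmersion.IsLeviCivita cov)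
    (J : Π x : M₁, TangentSpace 𝓘(ℝ, V) x →L[ℝ] TangentSpace 𝓘(ℝ, V) x)
    (hJ : SemiInvariantSubmersion.IsKahler cov J)
    (F : M₁ → M₂)
    (D₁ : Π x : M₁, Submodule ℝ (TangentSpace 𝓘(ℝ, V) x))
    (hF : SemiInvariantSubmersion.IsSemiInvariant W F J D₁)
    (hD₁ : ∀ x, D₁ x ≠ ⊥)
    (humb : SemiInvariantSubmersion.HasTotallyUmbilicalFibers W cov F) :
    SemiInvariantSubmersion.SmoothSection (SemiInvariantSubmersion.JD₂ W F J D₁)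
        (SemiInvariantSubmersion.meanCurvature W cov F) ∧
      ∀ x, (SemiInvariantSubmersion.mu W F J D₁ x).starProjection
        (SemiInvariantSubmersion.meanCurvature W cov F x) = 0 := by

  have hmem := fun x ↦ hF.meanCurvature_mem_JD₂ hJ humb (hD₁ x)
  refine ⟨⟨hF.toIsRiemannianSubmersion.smoothField_meanCurvature hcov humb fun p ↦ ?_, hmem⟩,
    fun x ↦ ?_⟩
  · obtain ⟨X, hX, hXp⟩ := hF.distribution.exists_smoothSection (hD₁ p)
    exact ⟨X, ⟨hX.1, fun y ↦ hF.le_vertical y (hX.2 y)⟩, hXp⟩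
  · rw [Submodule.starProjection_apply_eq_zero_iff]
    exact (Submodule.mem_orthogonal' _ _).2 fun w hw ↦
      (Submodule.mem_orthogonal _ _).1 hw.2 _ (hmem x)
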